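/- Let $U$ be a universal prefix machine: a Turing machine with a one-way read-only input tape, a work tape and an output tape, which halts on a program $p$ when it has scanned exactly the bits of $p$, and which simulates every partial recursive function $f$ on binary strings with prefix-free domain (there is a string $\sigma$ with $U(\sigma p)=f(p)$ for all $p$). For a binary string $x$ put $K(x)=\min\{|p|:U(p)=x\}$ and $Q_U(x)=\sum_{U(p)=x}2^{-|p|}$. For a time-constructible $t:\mathbb N\to\mathbb N$ (that is, $t(n)$ is computable from $n$ by a Turing machine in $O(t(n))$ steps) let $K^t(x)$ and $Q^t_U(x)$ be the same quantities with $p$ restricted to the programs on which $U$ outputs $x$ and halts in at most $t(|x|)$ steps, and put $\mathrm{depth}^t(x)=K^t(x)-K(x)$. The logical depth of $x$ at significance level $b$ is $$\mathrm{ldepth}_b(x)=\min\{t(|x|): Q^t_U(x)/Q_U(x)\ge 2^{-b}\},$$ the minimum being over all time-constructible $t$ (and $\infty$ if there is none). For $b\in\mathbb N$ let $K(b)$ be the complexity of the $b$-th binary string in the length-increasing lexicographic order, and for a recursive $t$ let $K(t)=\min\{i: T_i\text{ computes }t\}$, where $T_1,T_2,\dots$ is a standard enumeration of the algorithms for partial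 recursive functions. **Theorem.** There is a constant $C\ge 0$, depending only on $U$, such that for every time-constructible $t$ and every binary string $x$: (i) if $b$ is the minimum value (among the integers, or among the reals) such that $\mathrm{ldepth}_b(x)=t(|x|)$, then $\mathrm{depth}^t(x)$ is finite and $\mathrm{depth}^t(x)\ge b-C$; (ii) if $\mathrm{depth}^t(x)=b$ (finite), then $$\frac{Q^t_U(x)}{Q_U(x)}\ge 2^{-b-\min\{K(b),K(t)\}-C},\qquad\text{that is,}\qquad \mathrm{ldepth}_{b+\min\{K(b),K(t)\}+C}(x)\le t(|x|).$$ -/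

import Mathlib

open scoped ENNReal

/-! ### Prefix machines

A deterministic Turing machine with a read-only input tape scanned from left to right without
backing up, a separate two-way infinite work tape, and a separate write-only output tape. -/

/-- What a machine does in one step, besides possibly scanning one input bit: the next state
(`none` is the halting state), the symbol written on the work tape, the move of the work head
(`some true` is right, `some false` is left, `none` is stay), and the bit appended to the output
(if any). -/
structure PrefixMachine.Action (numStates numSymbols : ℕ) where
  next : Option (Fin numStates)
  write : Fin (numSymbols + 1)
  move : Option Bool
  emit : Option Bool

/-- A prefix machine. The work alphabet is `Fin (numSymbols + 1)`, with `0` as the blank. In a state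
`q` with `reads q = true` each step scans the next input bit, which the transition function
receives as `some bit`; in the other states no input is scanned and it receives `none`. -/
structure PrefixMachine where
  numStates : ℕ
  numSymbols : ℕ
  start : Fin numStates
  reads : Fin numStates → Bool
  δ : Fin numStates → Option Bool → Fin (numSymbols + 1) →
    PrefixMachine.Action numStates numSymbols

namespace PrefixMachine

/-- A configuration: the state (`none` once halted), the work tape (cells to the left of the head,
nearest first; the scanned cell; cells to the right of the head, nearest first; cells beyond the
lists are blank), the input bits not yet scanned, and the contents of the output tape. -/
structure Cfg (M : PrefixMachine) where
  state : Option (Fin M.numStates)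
  left : List (Fin (M.numSymbols + 1))
  head : Fin (M.numSymbols + 1)
  right : List (Fin (M.numSymbols + 1))
  input : List Bool
  output : List Bool

/-- The initial configuration on input `p`: blank work tape, empty output tape. -/
def init (M : PrefixMachine) (p : List Bool) : M.Cfg :=
  ⟨some M.start, [], 0, [], p, []⟩

/-- Carry out an action in the configuration `c`, leaving `input` as the unscanned input. -/
def act (M : PrefixMachine) (a : Action M.numStates M.numSymbols) (c : M.Cfg)
    (input : List Bool) : M.Cfg :=
  match a.move with
  | none => ⟨a.next, c.left, a.write, c.right, input, c.output ++ a.emit.toList⟩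
  | some true =>
      ⟨a.next, a.write :: c.left, c.right.headD 0, c.right.tail, input,
        c.output ++ a.emit.toList⟩
  | some false =>
      ⟨a.next, c.left.tail, c.left.headD 0, a.write :: c.right, input,
        c.output ++ a.emit.toList⟩

/-- One step. There is no successor if the machine has halted, or if it wants to scan a bit beyond
the end of the given input. -/
def step (M : PrefixMachine) (c : M.Cfg) : Option M.Cfg :=
  match c.state with
  | none => none
  | some q =>
    if M.reads q then
      match c.input with
      | [] => none
      | i :: rest => some (M.act (M.δ q (some i) c.head) c rest)
    else
      some (M.act (M.δ q none c.head) c c.input)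

/-- The configuration after exactly `s` steps on input `p`, if it exists. -/
def run (M : PrefixMachine) (p : List Bool) : ℕ → Option M.Cfg
  | 0 => some (M.init p)
  | s + 1 => (M.run p s).bind M.step

/-- `M` halts on the program `p` after exactly `s` steps with output `x`, having scanned exactly
the bits of `p`. -/
def HaltsIn (M : PrefixMachine) (p x : List Bool) (s : ℕ) : Prop :=
  ∃ c : M.Cfg, M.run p s = some c ∧ c.state = none ∧ c.input = [] ∧ c.output = x

/-- `M(p) = x`. -/
def Computes (M : PrefixMachine) (p x : List Bool) : Prop :=
  ∃ s, M.HaltsIn p x s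

/-- `M(p) = x` in at most `T` steps. -/
def ComputesWithin (M : PrefixMachine) (T : ℕ) (p x : List Bool) : Prop :=
  ∃ s ≤ T, M.HaltsIn p x s

/-- No element of the set is a proper prefix of another one. -/
def _root_.PrefixFree (S : Set (List Bool)) : Prop :=
  ∀ p ∈ S, ∀ q ∈ S, p <+: q → p = q

/-- `U` is a universal prefix machine: it simulates every partial recursive function `f` on binary
strings with prefix-free domain, when a suitable string `σ` is put in front of the argument. -/
def Universal (U : PrefixMachine) : Prop :=
  ∀ f : List Bool →. List Bool, Partrec f → PrefixFree f.Dom →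
    ∃ σ : List Bool, ∀ p x : List Bool, U.Computes (σ ++ p) x ↔ x ∈ f p

/-- For a universal machine every string has a program. -/
theorem Universal.exists_program {U : PrefixMachine} (hU : U.Universal) (x : List Bool) :
    ∃ p, U.Computes p x := by
  have hf : Partrec (fun p : List Bool => ((if p = [] then some x else none : Option (List Bool)) :
      Part (List Bool))) := by
    apply Computable.ofOption
    exact Primrec.to_comp
      (Primrec.ite (PrimrecRel.comp Primrec.eq Primrec.id (Primrec.const []))
        (Primrec.const _) (Primrec.const _))
  obtain ⟨σ, hσ⟩ := hU _ hf (by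
    intro p hp q hq _
    have key : ∀ r : List Bool, ((if r = [] then some x else none : Option (List Bool)) :
        Part (List Bool)).Dom → r = [] := by
      intro r hr
      by_contra h
      simp [h] at hr
    rw [key p hp, key q hq])
  exact ⟨σ ++ [], (hσ [] x).2 (by simp)⟩

end PrefixMachine

/-! ### Kolmogorov complexity and a priori probability -/

section Complexity

variable (U : PrefixMachine)

/-- The prefix complexity `K(x)`, the length of a shortest program for `x`. -/
noncomputable def K (x : List Bool) : ℕ :=
  sInf {n : ℕ | ∃ p : List Bool, p.length = n ∧ U.Computes p x}

/-- The `t`-time-bounded prefix complexity `K^t(x)`; it is `⊤` if no program computes `x` in at most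
`t(|x|)` steps. -/
noncomputable def Ktime (t : ℕ → ℕ) (x : List Bool) : ℕ∞ :=
  sInf {n : ℕ∞ | ∃ p : List Bool, (p.length : ℕ∞) = n ∧ U.ComputesWithin (t x.length) p x}

/-- The universal a priori probability `Q_U(x)`. -/
noncomputable def Q (x : List Bool) : ℝ≥0∞ :=
  ∑' p : {p : List Bool // U.Computes p x}, (2⁻¹ : ℝ≥0∞) ^ p.1.length

/-- The `t`-time-bounded universal a priori probability `Q_U^t(x)`. -/
noncomputable def Qtime (t : ℕ → ℕ) (x : List Bool) : ℝ≥0∞ :=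
  ∑' p : {p : List Bool // U.ComputesWithin (t x.length) p x}, (2⁻¹ : ℝ≥0∞) ^ p.1.length

/-- The binary string that corresponds to the natural number `n` in the length-increasing
lexicographic order: `ε, 0, 1, 00, 01, 10, 11, 000, …`, that is, the binary expansion of `n + 1`
without its leading `1`. -/
def natString (n : ℕ) : List Bool :=
  ((n + 1).bits.dropLast).reverse

end Complexity

/-- `t` is time-constructible: some Turing machine (with finitely many stacks) computes `t(n)` from
`n`, both written in binary, in a number of steps that is `O(t(n))`. -/
def TimeConstructible (t : ℕ → ℕ) : Prop :=
  ∃ (tm : Turing.FinTM2) (ein : tm.Γ tm.k₀ ≃ Bool) (eout : tm.Γ tm.k₁ ≃ Bool) (τ : ℕ → ℕ),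
    (fun n => (τ n : ℝ)) =O[Filter.atTop] (fun n => (t n : ℝ)) ∧
    ∀ n : ℕ, ∃ c : tm.Cfg, c.l = none ∧
      c.stk tm.k₁ = (Computability.encodeNat (t n)).map eout.symm ∧
      Nonempty (StateTransition.EvalsToInTime tm.step
        (Turing.initList tm ((Computability.encodeNat n).map ein.symm)) (some c) (τ n))

/-- The complexity of a function `t`: the least index `i ≥ 1` such that the `i`-th algorithm
`T_1, T_2, …` in the standard enumeration computes `t` (`⊤` if `t` is not recursive). -/
noncomputable def Kfun (t : ℕ → ℕ) : ℕ∞ :=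
  sInf {i : ℕ∞ | ∃ j : ℕ, ((j + 1 : ℕ) : ℕ∞) = i ∧
    ∀ n : ℕ, (Denumerable.ofNat Nat.Partrec.Code j).eval n = Part.some (t n)}

/-- The logical depth of `x` at significance level `b`: the minimum of `t(|x|)` over all
time-constructible `t` with `Q_U^t(x) / Q_U(x) ≥ 2^{-b}` (`⊤` if there is no such `t`). -/
noncomputable def ldepth (U : PrefixMachine) (b : ℝ) (x : List Bool) : ℕ∞ :=
  sInf {T : ℕ∞ | ∃ t : ℕ → ℕ, TimeConstructible t ∧ (t x.length : ℕ∞) = T ∧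
    (2 : ℝ≥0∞) ^ (-b) ≤ Qtime U t x / Q U x}

/-- The basic computational depth `depth^t(x) = K^t(x) - K(x)`. -/
noncomputable def depth (U : PrefixMachine) (t : ℕ → ℕ) (x : List Bool) : ℕ∞ :=
  Ktime U t x - (K U x : ℕ∞)

/-! ### Kraft's inequality for prefix-free sets -/

/-! Everything rests on two bounds. A shortest program among those that halt in time gives `Q^t(x) ≥
2^{-K^t(x)}`, and Levin's coding theorem (`Universal.exists_Q_le`) gives `Q(x) ≤ 2^{C-K(x)}`.
Dividing, `Q^t(x)/Q(x) ≥ 2^{-depth^t(x)-C}`. This is already stronger than (ii): the term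
`min{K(b),K(t)}` is nonnegative and only weakens the bound.

For (i), `ldepth_le_iff` turns logical depth into a condition on the ratio. Since the level `b-1`
fails, `Q^t(x)/Q(x) < 2^{1-b}`, and comparison with the lower bound gives `depth^t(x) > b-1-C`.
Since the level `b` holds, the ratio is positive, so some program halts in time and the depth is
finite.

The coding theorem is proved by enumerating lower approximations of `Q`. Once `Q(x) ≥ 2^{-k}` is
seen, a codeword for `x` of weight `2^{-(k+1)}` is requested. For fixed `x` these weights add up to
at most `Q(x)`, so by Kraft's inequality all of them together weigh at most `1`. The Kraft–Chaitin
theorem (`exists_prefixFree_decoder`) then yields a prefix-free decoder, which the universal machine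
simulates at the cost of a fixed prefix. -/

theorem PrefixFree.uniquelyDecodable {S : Set (List Bool)} (hS : PrefixFree S) (h0 : [] ∉ S) :
    InformationTheory.UniquelyDecodable S := by
  intro L₁
  induction L₁ with
  | nil =>
    intro L₂ _ h₂ h
    cases L₂ with
    | nil => rfl
    | cons w L =>
      simp only [List.flatten_nil, List.flatten_cons] at h
      have hw : w = [] := (List.append_eq_nil_iff.1 h.symm).1
      exact absurd (hw ▸ h₂ w (by simp)) h0
  | cons v L₁ ih =>
    intro L₂ h₁ h₂ h
    cases L₂ with
    | nil =>
      simp only [List.flatten_nil, List.flatten_cons] at h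
      have hw : v = [] := (List.append_eq_nil_iff.1 h).1
      exact absurd (hw ▸ h₁ v (by simp)) h0
    | cons w L =>
      simp only [List.flatten_cons] at h
      have hv := h₁ v (by simp)
      have hw := h₂ w (by simp)
      have hvw : v = w := by
        have p₁ : v <+: v ++ L₁.flatten := List.prefix_append _ _
        have p₂ : w <+: v ++ L₁.flatten := h ▸ List.prefix_append _ _
        rcases List.prefix_or_prefix_of_prefix p₁ p₂ with p | p
        · exact hS v hv w hw p
        · exact (hS w hw v hv p).symm
      subst hvw
      rw [ih L (fun u hu => h₁ u (by simp [hu])) (fun u hu => h₂ u (by simp [hu]))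
        (List.append_cancel_left h)]

/-- Kraft–McMillan needs unique decodability, which fails if the empty word is a codeword; but a
prefix-free set with the empty word has no other element. -/
theorem PrefixFree.sum_le_one {S : Set (List Bool)} (hS : PrefixFree S) (F : Finset (List Bool))
    (hF : (F : Set (List Bool)) ⊆ S) : ∑ p ∈ F, (2⁻¹ : ℝ) ^ p.length ≤ 1 := by
  have hF' : PrefixFree (F : Set (List Bool)) := fun p hp q hq => hS p (hF hp) q (hF hq)
  by_cases h0 : [] ∈ F
  · have : F = {[]} := by
      ext p
      simp only [Finset.mem_singleton]
      exact ⟨fun hp => (hF' [] h0 p hp List.nil_prefix).symm, fun h => h ▸ h0⟩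
    simp [this]
  · simpa using InformationTheory.kraft_mcmillan_inequality
      (hF'.uniquelyDecodable (by simpa using h0))

theorem PrefixFree.tsum_le_one {S : Set (List Bool)} (hS : PrefixFree S) :
    ∑' p : S, (2⁻¹ : ℝ≥0∞) ^ p.1.length ≤ 1 := by
  rw [ENNReal.tsum_eq_iSup_sum]
  refine iSup_le fun F => ?_
  have h := hS.sum_le_one (F.map (Function.Embedding.subtype _)) (by simp)
  rw [Finset.sum_map] at h
  have h2 : ∑ p ∈ F, (2⁻¹ : ℝ≥0∞) ^ p.1.length
      = ENNReal.ofReal (∑ p ∈ F, (2⁻¹ : ℝ) ^ p.1.length) := by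
    rw [ENNReal.ofReal_sum_of_nonneg fun _ _ => by positivity]
    refine Finset.sum_congr rfl fun p _ => ?_
    rw [ENNReal.ofReal_pow (by norm_num), ENNReal.ofReal_inv_of_pos (by norm_num)]
    simp
  rw [h2]
  exact ENNReal.ofReal_le_one.2 (by simpa using h)

/-! ### Binary strings as dyadic intervals -/

/-- The number with binary expansion `w`. -/
def bitsVal (w : List Bool) : ℕ := w.foldl (fun n b => 2 * n + b.toNat) 0

theorem foldl_bits_eq (w : List Bool) (n : ℕ) :
    w.foldl (fun n b => 2 * n + b.toNat) n = n * 2 ^ w.length + bitsVal w := by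
  unfold bitsVal
  induction w generalizing n with
  | nil => simp
  | cons b w ih =>
    simp only [List.foldl_cons, List.length_cons]
    rw [ih, ih (2 * 0 + b.toNat)]
    ring

theorem bitsVal_append (w v : List Bool) :
    bitsVal (w ++ v) = bitsVal w * 2 ^ v.length + bitsVal v := by
  rw [← foldl_bits_eq, bitsVal, List.foldl_append, bitsVal]

theorem bitsVal_lt (w : List Bool) : bitsVal w < 2 ^ w.length := by
  induction w using List.reverseRecOn with
  | nil => simp [bitsVal]
  | append_singleton w b ih =>
    rw [bitsVal_append, List.length_append]
    cases b <;> simp [bitsVal, pow_succ] at * <;> omega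

theorem exists_bitsVal_eq (m c : ℕ) (hc : c < 2 ^ m) : ∃ w, w.length = m ∧ bitsVal w = c := by
  induction m generalizing c with
  | zero => exact ⟨[], rfl, by simp at hc; simp [bitsVal, hc]⟩
  | succ m ih =>
    obtain ⟨w, hw, hv⟩ := ih (c / 2) (by rw [pow_succ] at hc; omega)
    refine ⟨w ++ [decide (c % 2 = 1)], by simp [hw], ?_⟩
    rw [bitsVal_append, hv]
    rcases Nat.mod_two_eq_zero_or_one c with h | h <;> simp [bitsVal, h] <;> omega

theorem primrec_bitsVal : Primrec bitsVal := by
  have hb : Primrec Bool.toNat := Primrec.dom_finite _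
  exact Primrec.list_foldl (h := fun _ (s : ℕ × Bool) => 2 * s.1 + s.2.toNat) Primrec.id (Primrec.const 0)
    (Primrec.nat_add.comp
      (Primrec.nat_mul.comp (Primrec.const 2) (Primrec.fst.comp Primrec.snd))
      (hb.comp (Primrec.snd.comp Primrec.snd))).to₂

/-- With the next lemma: extending a word shrinks its dyadic interval `[bitsVal w / 2^|w|, (bitsVal
w + 1) / 2^|w|)` to a subinterval. -/
theorem bitsVal_div_le_append (w v : List Bool) :
    (bitsVal w : ℝ) / 2 ^ w.length ≤ bitsVal (w ++ v) / 2 ^ (w ++ v).length := by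
  rw [div_le_div_iff₀ (by positivity) (by positivity), bitsVal_append, List.length_append, pow_add]
  push_cast
  nlinarith [show (0 : ℝ) ≤ bitsVal v * 2 ^ w.length by positivity]

theorem bitsVal_succ_div_append_le (w v : List Bool) :
    ((bitsVal (w ++ v) : ℝ) + 1) / 2 ^ (w ++ v).length ≤ (bitsVal w + 1) / 2 ^ w.length := by
  rw [div_le_div_iff₀ (by positivity) (by positivity), bitsVal_append, List.length_append, pow_add]
  have h : (bitsVal v : ℝ) + 1 ≤ 2 ^ v.length := by exact_mod_cast bitsVal_lt v
  push_cast
  nlinarith [mul_le_mul_of_nonneg_right h (show (0 : ℝ) ≤ 2 ^ w.length by positivity)]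

/-! ### Bounded sums are primitive recursive -/

theorem Primrec.sum_range {α : Type*} [Primcodable α] {f : α → ℕ → ℕ} {n : α → ℕ}
    (hf : Primrec₂ f) (hn : Primrec n) : Primrec fun a => ∑ i ∈ Finset.range (n a), f a i := by
  refine (Primrec.nat_rec' (h := fun a s => s.2 + f a s.1) hn (Primrec.const 0)
    (Primrec.nat_add.comp (Primrec.snd.comp Primrec.snd)
      (hf.comp Primrec.fst (Primrec.fst.comp Primrec.snd))).to₂).of_eq fun a => ?_
  induction n a with
  | zero => rfl
  | succ k ih => rw [Finset.sum_range_succ, ← ih]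

theorem Primrec.two_pow : Primrec fun n : ℕ => 2 ^ n := by
  refine (Primrec.nat_rec' (h := fun _ s => 2 * s.2) Primrec.id (Primrec.const 1)
    (Primrec.nat_mul.comp (Primrec.const 2) (Primrec.snd.comp Primrec.snd)).to₂).of_eq fun n => ?_
  simp only [id]
  induction n with
  | zero => rfl
  | succ k ih => rw [pow_succ, ← ih, mul_comm]

/-! ### The Kraft–Chaitin theorem -/

section KraftChaitin

variable (req : ℕ → Option (List Bool × ℕ))

/-- The probability `2^{-k}` asked for by the request `(x, k)`. -/
noncomputable def requestWeight (o : Option (List Bool × ℕ)) : ℝ :=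
  o.elim 0 fun r => (2⁻¹ : ℝ) ^ r.2

/-- The total weight of the first `i` requests. -/
noncomputable def cumWeight (i : ℕ) : ℝ := ∑ j ∈ Finset.range i, requestWeight (req j)

/-- A common binary precision of the first `i` requests. -/
def requestPrecision (i : ℕ) : ℕ := ∑ j ∈ Finset.range i, (req j).elim 0 Prod.snd

/-- The total weight of the first `i` requests in units of `2^{-m}`. -/
def scaledCumWeight (i m : ℕ) : ℕ :=
  ∑ j ∈ Finset.range i, (req j).elim 0 fun r => 2 ^ (m - r.2)

theorem requestWeight_nonneg (o : Option (List Bool × ℕ)) : 0 ≤ requestWeight o := by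
  cases o <;> simp [requestWeight]

theorem cumWeight_mono : Monotone (cumWeight req) :=
  monotone_nat_of_le_succ fun i => by
    rw [cumWeight, cumWeight, Finset.sum_range_succ]
    linarith [requestWeight_nonneg (req i)]

theorem cumWeight_nonneg (i : ℕ) : 0 ≤ cumWeight req i :=
  Finset.sum_nonneg fun _ _ => requestWeight_nonneg _

/-- The precision bounds every exponent requested so far, so the truncated subtraction in `2 ^ (m -
r.2)` is exact. This lets the decoder compare real endpoints by integer arithmetic. -/
theorem scaledCumWeight_eq (i m : ℕ) (hm : requestPrecision req i ≤ m) :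
    (scaledCumWeight req i m : ℝ) = cumWeight req i * 2 ^ m := by
  rw [scaledCumWeight, cumWeight, Finset.sum_mul, Nat.cast_sum]
  refine Finset.sum_congr rfl fun j hj => ?_
  have hle : (req j).elim 0 Prod.snd ≤ m :=
    (Finset.single_le_sum (f := fun j => (req j).elim 0 Prod.snd)
      (fun _ _ => Nat.zero_le _) hj).trans hm
  cases h : req j with
  | none => simp [requestWeight]
  | some r =>
    rw [h] at hle
    simp only [Option.elim_some] at hle
    simp only [requestWeight, Option.elim_some, Nat.cast_pow, Nat.cast_ofNat]
    rw [pow_sub₀ _ (by norm_num) hle, inv_pow, mul_comm]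

/-- The output of the `i`-th request `(x, k)` if `w` is a string of length `k + 1` whose dyadic
interval lies within the interval that the request has been given. -/
def requestDecode (w : List Bool) (i : ℕ) : Option (List Bool) :=
  (req i).bind fun r =>
    if w.length = r.2 + 1 ∧
        scaledCumWeight req i (requestPrecision req (i + 1)) * 2 ^ w.length
          ≤ bitsVal w * 2 ^ requestPrecision req (i + 1) ∧
        (bitsVal w + 1) * 2 ^ requestPrecision req (i + 1)
          ≤ scaledCumWeight req (i + 1) (requestPrecision req (i + 1)) * 2 ^ w.length
    then some r.1 else none

theorem mem_requestDecode {w x : List Bool} {i : ℕ} :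
    x ∈ requestDecode req w i ↔ ∃ k, req i = some (x, k) ∧ w.length = k + 1 ∧
      cumWeight req i ≤ bitsVal w / 2 ^ w.length ∧
      ((bitsVal w : ℝ) + 1) / 2 ^ w.length ≤ cumWeight req (i + 1) := by
  have hmono : requestPrecision req i ≤ requestPrecision req (i + 1) := by
    rw [requestPrecision, requestPrecision, Finset.sum_range_succ]
    exact Nat.le_add_right _ _
  have h2 : ∀ n, (0 : ℝ) < 2 ^ n := fun n => by positivity
  have e₁ : scaledCumWeight req i (requestPrecision req (i + 1)) * 2 ^ w.length
      ≤ bitsVal w * 2 ^ requestPrecision req (i + 1) ↔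
      cumWeight req i ≤ bitsVal w / 2 ^ w.length := by
    rw [← Nat.cast_le (α := ℝ), le_div_iff₀ (h2 _)]
    push_cast
    rw [scaledCumWeight_eq req _ _ hmono, mul_right_comm, mul_le_mul_iff_left₀ (h2 _)]
  have e₂ : (bitsVal w + 1) * 2 ^ requestPrecision req (i + 1)
      ≤ scaledCumWeight req (i + 1) (requestPrecision req (i + 1)) * 2 ^ w.length ↔
      ((bitsVal w : ℝ) + 1) / 2 ^ w.length ≤ cumWeight req (i + 1) := by
    rw [← Nat.cast_le (α := ℝ), div_le_iff₀ (h2 _)]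
    push_cast
    rw [scaledCumWeight_eq req _ _ le_rfl, mul_right_comm, mul_le_mul_iff_left₀ (h2 _)]
  simp only [requestDecode, e₁, e₂, Option.mem_def, Option.bind_eq_some_iff,
    Option.ite_none_right_eq_some, Option.some.injEq, Prod.exists]
  constructor
  · rintro ⟨y, k, h, h', rfl⟩
    exact ⟨k, h, h'⟩
  · rintro ⟨k, h, h'⟩
    exact ⟨x, k, h, h', rfl⟩

/-- The interval of `w ++ v` is nonempty and lies in that of `w`, while distinct requests own
disjoint intervals. This serves both prefix-freeness and, with `v = []`, uniqueness of the request
that `w` answers. -/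
theorem requestDecode_index_eq {w v x y : List Bool} {i j : ℕ} (hx : x ∈ requestDecode req w i)
    (hy : y ∈ requestDecode req (w ++ v) j) : i = j := by
  obtain ⟨k, -, -, h₁, h₂⟩ := (mem_requestDecode req).1 hx
  obtain ⟨l, -, -, h₃, h₄⟩ := (mem_requestDecode req).1 hy
  have a := bitsVal_div_le_append w v
  have b := bitsVal_succ_div_append_le w v
  have c : (bitsVal (w ++ v) : ℝ) / 2 ^ (w ++ v).length
      < (bitsVal (w ++ v) + 1) / 2 ^ (w ++ v).length := by
    gcongr
    linarith
  have p := (cumWeight_mono req).reflect_lt (show cumWeight req i < cumWeight req (j + 1) by linarith)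
  have q := (cumWeight_mono req).reflect_lt (show cumWeight req j < cumWeight req (i + 1) by linarith)
  omega

theorem exists_mem_requestDecode {x : List Bool} {i k : ℕ} (hi : req i = some (x, k))
    (hsum : cumWeight req (i + 1) ≤ 1) :
    ∃ w : List Bool, w.length = k + 1 ∧ x ∈ requestDecode req w i := by
  have hs : cumWeight req (i + 1) = cumWeight req i + (2⁻¹ : ℝ) ^ k := by
    rw [cumWeight, Finset.sum_range_succ, hi]
    rfl
  have hp : (2⁻¹ : ℝ) ^ k * 2 ^ (k + 1) = 2 := by
    rw [pow_succ, ← mul_assoc, ← mul_pow]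
    norm_num
  -- The request owns an interval of length two in units of `2^{-(k+1)}`, so rounding its left end
  -- up leaves room for a full aligned unit. This is where the extra bit is spent.
  set c := ⌈cumWeight req i * 2 ^ (k + 1)⌉₊ with hc
  have h2 : (0 : ℝ) < 2 ^ (k + 1) := by positivity
  have hle : cumWeight req i * 2 ^ (k + 1) ≤ c := Nat.le_ceil _
  have hlt : (c : ℝ) < cumWeight req i * 2 ^ (k + 1) + 1 :=
    Nat.ceil_lt_add_one (mul_nonneg (cumWeight_nonneg req i) h2.le)
  have hub : (c : ℝ) + 1 ≤ cumWeight req (i + 1) * 2 ^ (k + 1) := by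
    rw [hs, add_mul, hp]
    linarith
  have hc2 : c < 2 ^ (k + 1) := by
    have : (c : ℝ) < 2 ^ (k + 1) := by nlinarith
    exact_mod_cast this
  obtain ⟨w, hw, hv⟩ := exists_bitsVal_eq _ _ hc2
  refine ⟨w, hw, (mem_requestDecode req).2 ⟨k, hi, hw, ?_, ?_⟩⟩
  · rw [hw, hv, le_div_iff₀ h2]
    exact hle
  · rw [hw, hv, div_le_iff₀ h2]
    exact hub

theorem primrec_requestDecode (hreq : Primrec req) : Primrec₂ (requestDecode req) := by
  have hprec : Primrec (requestPrecision req) := by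
    have h : Primrec fun j => (req j).elim 0 Prod.snd :=
      (Primrec.option_casesOn hreq (Primrec.const 0)
        (Primrec.snd.comp Primrec.snd).to₂).of_eq fun j => by cases req j <;> rfl
    exact Primrec.sum_range (f := fun _ j => (req j).elim 0 Prod.snd) (h.comp Primrec.snd).to₂
      Primrec.id
  have hcum : Primrec₂ (scaledCumWeight req) := by
    have h : Primrec₂ fun (a : ℕ × ℕ) j => (req j).elim 0 fun r => 2 ^ (a.2 - r.2) :=
      (Primrec.option_casesOn (hreq.comp Primrec.snd) (Primrec.const 0)
        (Primrec.two_pow.comp (Primrec.nat_sub.comp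
          (Primrec.snd.comp (Primrec.fst.comp Primrec.fst))
          (Primrec.snd.comp Primrec.snd))).to₂).of_eq fun a => by cases h : req a.2 <;> simp [h]
    exact Primrec.sum_range h Primrec.fst
  have hw : Primrec fun a : (List Bool × ℕ) × (List Bool × ℕ) => a.1.1 :=
    Primrec.fst.comp Primrec.fst
  have hi : Primrec fun a : (List Bool × ℕ) × (List Bool × ℕ) => a.1.2 :=
    Primrec.snd.comp Primrec.fst
  have hm : Primrec fun a : (List Bool × ℕ) × (List Bool × ℕ) => requestPrecision req (a.1.2 + 1) :=
    hprec.comp (Primrec.succ.comp hi)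
  have hlen := Primrec.list_length.comp hw
  have hval := primrec_bitsVal.comp hw
  have hfit := (Primrec.eq.comp hlen (Primrec.succ.comp (Primrec.snd.comp Primrec.snd))).and
    ((Primrec.nat_le.comp
      (Primrec.nat_mul.comp (hcum.comp hi hm) (Primrec.two_pow.comp hlen))
      (Primrec.nat_mul.comp hval (Primrec.two_pow.comp hm))).and
    (Primrec.nat_le.comp
      (Primrec.nat_mul.comp (Primrec.succ.comp hval) (Primrec.two_pow.comp hm))
      (Primrec.nat_mul.comp (hcum.comp (Primrec.succ.comp hi) hm) (Primrec.two_pow.comp hlen))))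
  have hite := Primrec.ite hfit
    (Primrec.option_some.comp (Primrec.fst.comp Primrec.snd)) (Primrec.const none)
  exact Primrec.option_bind (hreq.comp Primrec.snd) (hite.of_eq fun _ => rfl).to₂

/-- The Kraft–Chaitin theorem, up to one extra bit: a sequence of requests `(x, k)` of total weight
`∑ 2^{-k} ≤ 1` is met by a partial recursive decoder with prefix-free domain. -/
theorem exists_prefixFree_decoder (hreq : Primrec req) (hsum : ∀ i, cumWeight req i ≤ 1) :
    ∃ f : List Bool →. List Bool, Partrec f ∧ PrefixFree f.Dom ∧
      ∀ i x k, req i = some (x, k) → ∃ w : List Bool, w.length = k + 1 ∧ x ∈ f w := by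
  refine ⟨fun w => Nat.rfindOpt (requestDecode req w),
    Partrec.rfindOpt (primrec_requestDecode req hreq).to_comp, ?_, ?_⟩
  · rintro w hw - hv ⟨v, rfl⟩
    obtain ⟨i, x, hx⟩ := Nat.rfindOpt_dom.1 hw
    obtain ⟨j, y, hy⟩ := Nat.rfindOpt_dom.1 hv
    obtain rfl := requestDecode_index_eq req hx hy
    obtain ⟨k, hk, hwk, -, -⟩ := (mem_requestDecode req).1 hx
    obtain ⟨l, hl, hvl, -, -⟩ := (mem_requestDecode req).1 hy
    -- Both words answer the same request, so they have the same length and the extension is empty.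
    have hkl : k = l := by simpa using congrArg (Option.map Prod.snd) (hk.symm.trans hl)
    have : v = [] := by
      rw [List.length_append] at hvl
      exact List.length_eq_zero_iff.1 (by omega)
    simp [this]
  · intro i x k hi
    obtain ⟨w, hw, hx⟩ := exists_mem_requestDecode req hi (hsum _)
    refine ⟨w, hw, ?_⟩
    have hd : (Nat.rfindOpt (requestDecode req w)).Dom := Nat.rfindOpt_dom.2 ⟨i, x, hx⟩
    obtain ⟨j, hj⟩ := Nat.rfindOpt_spec (Part.get_mem hd)
    obtain rfl : i = j :=
      requestDecode_index_eq (v := []) req hx (by rw [List.append_nil]; exact hj)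
    have := Option.mem_unique hj hx
    exact this ▸ Part.get_mem hd

end KraftChaitin

namespace PrefixMachine

variable (M : PrefixMachine)

/-! ### Runs of a prefix machine -/

/-- One step of the machine; a configuration without successor stays as it is. -/
def advance (c : M.Cfg) : M.Cfg := (M.step c).getD c

theorem advance_of_state_eq_none {c : M.Cfg} (h : c.state = none) : M.advance c = c := by
  simp [advance, step, h]

theorem iterate_advance_of_run {p : List Bool} {s : ℕ} {c : M.Cfg} (h : M.run p s = some c) :
    M.advance^[s] (M.init p) = c := by
  induction s generalizing c with
  | zero => simpa [run] using h
  | succ s ih =>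
    obtain ⟨d, hd, hc⟩ := Option.bind_eq_some_iff.1 h
    rw [Function.iterate_succ_apply', ih hd, advance, hc, Option.getD_some]

theorem exists_run_eq_iterate_advance (p : List Bool) (n : ℕ) :
    ∃ s ≤ n, M.run p s = some (M.advance^[n] (M.init p)) := by
  induction n with
  | zero => exact ⟨0, le_rfl, rfl⟩
  | succ n ih =>
    obtain ⟨s, hs, hr⟩ := ih
    rw [Function.iterate_succ_apply']
    cases h : M.step (M.advance^[n] (M.init p)) with
    | none => exact ⟨s, by omega, by rw [hr, advance, h, Option.getD_none]⟩
    | some c =>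
      exact ⟨s + 1, by omega, by rw [run, hr, Option.bind_some, advance, h, Option.getD_some]⟩

/-- Halted configurations are fixed by `advance`, so a time bound can be tested on the `n`-th
iterate alone; hence the predicate is decidable and primitive recursive. -/
theorem computesWithin_iff {n : ℕ} {p x : List Bool} :
    M.ComputesWithin n p x ↔ (M.advance^[n] (M.init p)).state = none ∧
      (M.advance^[n] (M.init p)).input = [] ∧ (M.advance^[n] (M.init p)).output = x := by
  constructor
  · rintro ⟨s, hs, c, hc, h⟩
    have : M.advance^[n] (M.init p) = c := by
      obtain ⟨k, rfl⟩ := Nat.exists_eq_add_of_le' hs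
      rw [Function.iterate_add_apply, M.iterate_advance_of_run hc]
      exact Function.iterate_fixed (M.advance_of_state_eq_none h.1) k
    rwa [this]
  · intro h
    obtain ⟨s, hs, hr⟩ := M.exists_run_eq_iterate_advance p n
    exact ⟨s, hs, _, hr, h⟩

instance (n : ℕ) (p x : List Bool) : Decidable (M.ComputesWithin n p x) :=
  decidable_of_iff _ M.computesWithin_iff.symm

variable {M}

theorem ComputesWithin.computes {n : ℕ} {p x : List Bool} (h : M.ComputesWithin n p x) :
    M.Computes p x :=
  let ⟨s, _, hs⟩ := h
  ⟨s, hs⟩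

theorem ComputesWithin.mono {m n : ℕ} {p x : List Bool} (h : M.ComputesWithin m p x)
    (hmn : m ≤ n) : M.ComputesWithin n p x :=
  let ⟨s, hsm, hs⟩ := h
  ⟨s, hsm.trans hmn, hs⟩

theorem Computes.output_unique {p x y : List Bool} (hx : M.Computes p x) (hy : M.Computes p y) :
    x = y := by
  obtain ⟨s, hs⟩ := hx
  obtain ⟨t, ht⟩ := hy
  have h₁ : M.ComputesWithin (max s t) p x := ⟨s, le_max_left _ _, hs⟩
  have h₂ : M.ComputesWithin (max s t) p y := ⟨t, le_max_right _ _, ht⟩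
  exact (M.computesWithin_iff.1 h₁).2.2.symm.trans (M.computesWithin_iff.1 h₂).2.2

theorem step_append {c d : M.Cfg} (h : M.step c = some d) (v : List Bool) :
    M.step { c with input := c.input ++ v } = some { d with input := d.input ++ v } := by
  rcases c with ⟨_ | q, l, s, r, input, o⟩
  · simp [step] at h
  · by_cases hq : M.reads q
    · cases input with
      | nil => simp [step, hq] at h
      | cons i rest =>
        simp only [step, hq, if_true, Option.some.injEq, List.cons_append] at h ⊢
        subst h
        unfold act
        rcases (M.δ q (some i) s).move with _ | _ | _ <;> rfl
    · simp only [step, hq, Bool.false_eq_true, if_false, Option.some.injEq] at h ⊢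
      subst h
      unfold act
      rcases (M.δ q none s).move with _ | _ | _ <;> rfl

theorem run_append {p : List Bool} {s : ℕ} {c : M.Cfg} (h : M.run p s = some c) (v : List Bool) :
    M.run (p ++ v) s = some { c with input := c.input ++ v } := by
  induction s generalizing c with
  | zero =>
    simp only [run, Option.some.injEq] at h ⊢
    subst h
    rfl
  | succ s ih =>
    obtain ⟨d, hd, hc⟩ := Option.bind_eq_some_iff.1 h
    rw [run, ih hd, Option.bind_some]
    exact step_append hc v

variable (M)

/-- On `p ++ v` the machine repeats its run on `p` and halts with `v` unscanned, which is a legal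
halt only for `v = []`. -/
theorem prefixFree_domain : PrefixFree {p | ∃ x, M.Computes p x} := by
  rintro p ⟨x, s, c, hc, h₁, h₂, -⟩ - ⟨y, t, ht⟩ ⟨v, rfl⟩
  have hr := M.iterate_advance_of_run (run_append hc v)
  have hw := (M.computesWithin_iff.1 (⟨t, Nat.le_add_left t s, ht⟩ :
    M.ComputesWithin (s + t) (p ++ v) y)).2.1
  rw [add_comm, Function.iterate_add_apply, hr,
    Function.iterate_fixed
      (M.advance_of_state_eq_none (c := { c with input := c.input ++ v }) h₁) t, h₂, List.nil_append] at hw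
  have hv : v = [] := hw
  rw [hv, List.append_nil]

theorem tsum_Q_le_one : ∑' x, Q M x ≤ 1 := by
  unfold Q
  rw [← ENNReal.tsum_sigma]
  refine le_trans ?_ M.prefixFree_domain.tsum_le_one
  let φ : (Σ x, {p : List Bool // M.Computes p x}) → {p | ∃ x, M.Computes p x} :=
    fun a => ⟨a.2.1, a.1, a.2.2⟩
  have hφ : Function.Injective φ := by
    rintro ⟨x, p, hp⟩ ⟨y, q, hq⟩ h
    have hpq : p = q := congrArg Subtype.val h
    subst hpq
    have hxy : x = y := hp.output_unique hq
    subst hxy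
    rfl
  exact ENNReal.tsum_comp_le_tsum_of_injective hφ _

/-! ### Runs are primitive recursive -/

/-- A configuration as a tuple. -/
def cfgEquiv : M.Cfg ≃ Option (Fin M.numStates) × List (Fin (M.numSymbols + 1)) ×
    Fin (M.numSymbols + 1) × List (Fin (M.numSymbols + 1)) × List Bool × List Bool where
  toFun c := (c.state, c.left, c.head, c.right, c.input, c.output)
  invFun a := ⟨a.1, a.2.1, a.2.2.1, a.2.2.2.1, a.2.2.2.2.1, a.2.2.2.2.2⟩
  left_inv _ := rfl
  right_inv _ := rfl

instance : Primcodable M.Cfg := Primcodable.ofEquiv _ M.cfgEquiv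

theorem primrec_cfgEquiv : Primrec M.cfgEquiv := Primrec.of_equiv

theorem primrec_state : Primrec (Cfg.state : M.Cfg → _) := Primrec.fst.comp M.primrec_cfgEquiv

theorem primrec_left : Primrec (Cfg.left : M.Cfg → _) :=
  Primrec.fst.comp (Primrec.snd.comp M.primrec_cfgEquiv)

theorem primrec_head : Primrec (Cfg.head : M.Cfg → _) :=
  Primrec.fst.comp (Primrec.snd.comp (Primrec.snd.comp M.primrec_cfgEquiv))

theorem primrec_right : Primrec (Cfg.right : M.Cfg → _) :=
  Primrec.fst.comp (Primrec.snd.comp (Primrec.snd.comp (Primrec.snd.comp M.primrec_cfgEquiv)))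

theorem primrec_input : Primrec (Cfg.input : M.Cfg → _) :=
  Primrec.fst.comp (Primrec.snd.comp (Primrec.snd.comp (Primrec.snd.comp
    (Primrec.snd.comp M.primrec_cfgEquiv))))

theorem primrec_output : Primrec (Cfg.output : M.Cfg → _) :=
  Primrec.snd.comp (Primrec.snd.comp (Primrec.snd.comp (Primrec.snd.comp
    (Primrec.snd.comp M.primrec_cfgEquiv))))

variable {M} in
theorem primrec_cfg_mk {α : Type*} [Primcodable α] {st : α → Option (Fin M.numStates)}
    {l r : α → List (Fin (M.numSymbols + 1))} {h : α → Fin (M.numSymbols + 1)}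
    {i o : α → List Bool} (hst : Primrec st) (hl : Primrec l) (hh : Primrec h) (hr : Primrec r)
    (hi : Primrec i) (ho : Primrec o) :
    Primrec fun a => (⟨st a, l a, h a, r a, i a, o a⟩ : M.Cfg) :=
  (Primrec.of_equiv_symm (e := M.cfgEquiv)).comp
    (hst.pair (hl.pair (hh.pair (hr.pair (hi.pair ho)))))

theorem primrec_init : Primrec M.init :=
  primrec_cfg_mk (Primrec.const _) (Primrec.const _) (Primrec.const _) (Primrec.const _)
    Primrec.id (Primrec.const _)

theorem primrec_list_headD {α : Type*} [Primcodable α] (d : α) :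
    Primrec fun l : List α => l.headD d :=
  (Primrec.option_getD.comp Primrec.list_head? (Primrec.const d)).of_eq fun l => by
    cases l <;> rfl

variable {M} in
theorem primrec_act {α : Type*} [Primcodable α] {q : α → Fin M.numStates} {b : α → Option Bool}
    {c : α → M.Cfg} {i : α → List Bool} (hq : Primrec q) (hb : Primrec b) (hc : Primrec c)
    (hi : Primrec i) : Primrec fun a => M.act (M.δ (q a) (b a) (c a).head) (c a) (i a) := by
  have hl := M.primrec_left.comp hc
  have hr := M.primrec_right.comp hc
  have harg : Primrec fun a => (q a, b a, (c a).head) := hq.pair (hb.pair (M.primrec_head.comp hc))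
  -- The transition table has a finite domain, so every function read off from it is primitive
  -- recursive.
  have hδ : ∀ {β : Type} [Primcodable β] (g : Action M.numStates M.numSymbols → β),
      Primrec fun a => g (M.δ (q a) (b a) (c a).head) := fun g =>
    (Primrec.dom_finite fun y : Fin M.numStates × Option Bool × Fin (M.numSymbols + 1) =>
      g (M.δ y.1 y.2.1 y.2.2)).comp harg
  have hnext := hδ Action.next
  have hwrite := hδ Action.write
  have hmove := hδ Action.move
  have hout := Primrec.list_append.comp (M.primrec_output.comp hc) (hδ fun a => a.emit.toList)
  refine (Primrec.option_casesOn hmove (primrec_cfg_mk hnext hl hwrite hr hi hout)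
    (Primrec.cond Primrec.snd
      (primrec_cfg_mk hnext (Primrec.list_cons.comp hwrite hl)
        ((primrec_list_headD 0).comp hr) (Primrec.list_tail.comp hr) hi hout |>.comp Primrec.fst)
      (primrec_cfg_mk hnext (Primrec.list_tail.comp hl) ((primrec_list_headD 0).comp hl)
        (Primrec.list_cons.comp hwrite hr) hi hout |>.comp Primrec.fst)).to₂).of_eq fun a => ?_
  unfold act
  rcases (M.δ (q a) (b a) (c a).head).move with _ | _ | _ <;> rfl

theorem primrec_advance : Primrec M.advance := by
  have hreads : Primrec fun a : M.Cfg × Fin M.numStates => M.reads a.2 :=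
    (Primrec.dom_finite M.reads).comp Primrec.snd
  have hin : Primrec fun a : M.Cfg × Fin M.numStates => a.1.input :=
    M.primrec_input.comp Primrec.fst
  have hscan : Primrec fun a : M.Cfg × Fin M.numStates =>
      (List.casesOn a.1.input a.1
        fun i rest => M.act (M.δ a.2 (some i) a.1.head) a.1 rest : M.Cfg) :=
    Primrec.list_casesOn hin Primrec.fst
      (primrec_act (Primrec.snd.comp Primrec.fst)
        (Primrec.option_some.comp (Primrec.fst.comp Primrec.snd)) (Primrec.fst.comp Primrec.fst)
        (Primrec.snd.comp Primrec.snd)).to₂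
  have hstay : Primrec fun a : M.Cfg × Fin M.numStates =>
      M.act (M.δ a.2 none a.1.head) a.1 a.1.input :=
    primrec_act Primrec.snd (Primrec.const none) Primrec.fst hin
  refine (Primrec.option_casesOn M.primrec_state Primrec.id
    (Primrec.cond hreads hscan hstay).to₂).of_eq fun c => ?_
  rcases c with ⟨_ | q, l, s, r, _ | ⟨i, rest⟩, o⟩
  · rfl
  · rfl
  all_goals
    cases hq : M.reads q <;> simp [advance, step, hq]

theorem primrecPred_computesWithin :
    PrimrecPred fun a : ℕ × List Bool × List Bool => M.ComputesWithin a.1 a.2.1 a.2.2 := by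
  have hc : Primrec fun a : ℕ × List Bool × List Bool => M.advance^[a.1] (M.init a.2.1) :=
    Primrec.nat_iterate Primrec.fst (M.primrec_init.comp (Primrec.fst.comp Primrec.snd))
      (M.primrec_advance.comp Primrec.snd).to₂
  refine ((Primrec.eq.comp (M.primrec_state.comp hc) (Primrec.const none)).and
    ((Primrec.eq.comp (M.primrec_input.comp hc) (Primrec.const [])).and
    (Primrec.eq.comp (M.primrec_output.comp hc) (Primrec.snd.comp Primrec.snd)))).of_eq
    fun a => M.computesWithin_iff.symm

end PrefixMachine

namespace PrefixMachine

variable (M : PrefixMachine)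

/-! ### Approximating the a priori probability from below -/

/-- The numerator over `2 ^ n` of the probability of the programs for `x` that have length at most
`n`, code less than `n`, and halt within `n` steps. -/
def programCount (x : List Bool) (n : ℕ) : ℕ :=
  ∑ j ∈ Finset.range n, (Encodable.decode (α := List Bool) j).elim 0 fun p =>
    if Encodable.encode p = j ∧ p.length ≤ n ∧ M.ComputesWithin n p x then 2 ^ (n - p.length) else 0

theorem two_pow_sub_eq {m n : ℕ} (h : m ≤ n) :
    (2 : ℝ≥0∞) ^ (n - m) = 2 ^ n * 2⁻¹ ^ m := by
  obtain ⟨k, rfl⟩ := Nat.exists_eq_add_of_le h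
  rw [Nat.add_sub_cancel_left, pow_add, mul_right_comm, ← mul_pow,
    ENNReal.mul_inv_cancel (by norm_num) (by norm_num), one_pow, one_mul]

theorem programCount_le (x : List Bool) (n : ℕ) : (M.programCount x n : ℝ≥0∞) ≤ 2 ^ n * Q M x := by
  classical
  -- `Q` rewritten as a sum over codes of programs; the test `encode p = j` keeps a program from
  -- being counted at several numbers.
  let g : ℕ → ℝ≥0∞ := fun j => (Encodable.decode (α := List Bool) j).elim 0 fun p =>
    if Encodable.encode p = j ∧ M.Computes p x then 2⁻¹ ^ p.length else 0
  have hg : ∑' j, g j = Q M x := by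
    refine Eq.trans ?_ (tsum_subtype {p : List Bool | M.Computes p x}
      fun p => (2⁻¹ : ℝ≥0∞) ^ p.length).symm
    rw [← (Encodable.encode_injective (α := List Bool)).tsum_eq (f := g)]
    · refine tsum_congr fun p => ?_
      simp [g, Set.indicator_apply]
    · intro j hj
      rw [Function.mem_support] at hj
      cases hd : Encodable.decode (α := List Bool) j with
      | none => simp [g, hd] at hj
      | some p =>
        simp only [g, hd, Option.elim_some, ne_eq, ite_eq_right_iff, Classical.not_imp] at hj
        exact ⟨p, hj.1.1⟩
  rw [programCount, ← hg, Nat.cast_sum]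
  refine le_trans ?_ (mul_le_mul_right (ENNReal.sum_le_tsum (Finset.range n)) (2 ^ n))
  rw [Finset.mul_sum]
  refine Finset.sum_le_sum fun j _ => ?_
  cases hd : Encodable.decode (α := List Bool) j with
  | none => simp [g, hd]
  | some p =>
    simp only [g, hd, Option.elim_some]
    split_ifs with h₁ h₂
    · rw [Nat.cast_pow, Nat.cast_ofNat, two_pow_sub_eq h₁.2.1]
    · exact absurd ⟨h₁.1, h₁.2.2.computes⟩ h₂
    · simp
    · simp

theorem exists_lt_programCount (x : List Bool) {q : ℝ≥0∞} (hq : q < Q M x) (m : ℕ) :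
    ∃ n, m ≤ n ∧ 2 ^ n * q ≤ M.programCount x n := by
  rw [Q, ENNReal.tsum_eq_iSup_sum, lt_iSup_iff] at hq
  obtain ⟨F, hF⟩ := hq
  choose s hs using fun p : {p : List Bool // M.Computes p x} => p.2
  let b : {p : List Bool // M.Computes p x} → ℕ := fun p =>
    Encodable.encode p.1 + 1 + p.1.length + s p
  let n := m + ∑ p ∈ F, b p
  have hb : ∀ p ∈ F, b p ≤ n := fun p hp =>
    (Finset.single_le_sum (f := b) (fun _ _ => Nat.zero_le _) hp).trans (Nat.le_add_left _ _)
  refine ⟨n, Nat.le_add_right _ _, (mul_le_mul_right hF.le _).trans ?_⟩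
  let e : {p : List Bool // M.Computes p x} ↪ ℕ :=
    ⟨fun p => Encodable.encode p.1, fun p q h => Subtype.ext (Encodable.encode_injective h)⟩
  have he : ∀ p, e p = Encodable.encode p.1 := fun _ => rfl
  have hsub : F.map e ⊆ Finset.range n := by
    intro j hj
    obtain ⟨p, hp, rfl⟩ := Finset.mem_map.1 hj
    have := hb p hp
    simp only [b] at this
    rw [Finset.mem_range, he]
    omega
  rw [programCount, Nat.cast_sum]
  refine le_trans ?_ (Finset.sum_le_sum_of_subset hsub)
  rw [Finset.sum_map, Finset.mul_sum]
  refine Finset.sum_le_sum fun p hp => ?_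
  have hbp := hb p hp
  simp only [b] at hbp
  have hlen : p.1.length ≤ n := by omega
  have hw : M.ComputesWithin n p.1 x := ⟨s p, by omega, hs p⟩
  simp only [he, Encodable.encodek, Option.elim_some, hlen, hw,
    and_self, if_true]
  rw [Nat.cast_pow, Nat.cast_ofNat, two_pow_sub_eq hlen]

theorem primrec_programCount : Primrec₂ M.programCount := by
  have hp : Primrec fun a : ((List Bool × ℕ) × ℕ) × List Bool => a.2 := Primrec.snd
  have hn : Primrec fun a : ((List Bool × ℕ) × ℕ) × List Bool => a.1.1.2 :=
    Primrec.snd.comp (Primrec.fst.comp Primrec.fst)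
  have hx : Primrec fun a : ((List Bool × ℕ) × ℕ) × List Bool => a.1.1.1 :=
    Primrec.fst.comp (Primrec.fst.comp Primrec.fst)
  have hcond := (Primrec.eq.comp (Primrec.encode.comp hp) (Primrec.snd.comp Primrec.fst)).and
    ((Primrec.nat_le.comp (Primrec.list_length.comp hp) hn).and
      (M.primrecPred_computesWithin.comp (hn.pair (hp.pair hx))))
  have hite := Primrec.ite hcond
    (Primrec.two_pow.comp (Primrec.nat_sub.comp hn (Primrec.list_length.comp hp)))
    (Primrec.const 0)
  have hterm : Primrec₂ fun (a : List Bool × ℕ) j =>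
      (Encodable.decode (α := List Bool) j).elim 0 fun p =>
        if Encodable.encode p = j ∧ p.length ≤ a.2 ∧ M.ComputesWithin a.2 p a.1
        then 2 ^ (a.2 - p.length) else 0 :=
    (Primrec.option_casesOn (Primrec.decode.comp Primrec.snd) (Primrec.const 0)
      hite.to₂).of_eq fun a => by
        cases h : Encodable.decode (α := List Bool) a.2 <;> simp [h]
  exact Primrec.sum_range hterm Primrec.snd

/-- At stage `n` the probability of `x` is seen to be at least `2^{-k}`. -/
def Exceeds (x : List Bool) (k n : ℕ) : Prop :=
  k ≤ n ∧ 2 ^ (n - k) ≤ M.programCount x n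

instance (x : List Bool) (k n : ℕ) : Decidable (M.Exceeds x k n) :=
  inferInstanceAs (Decidable (_ ∧ _))

theorem Exceeds.le_Q {M : PrefixMachine} {x : List Bool} {k n : ℕ} (h : M.Exceeds x k n) :
    (2⁻¹ : ℝ≥0∞) ^ k ≤ Q M x := by
  have h₁ : (2 : ℝ≥0∞) ^ (n - k) ≤ M.programCount x n := by exact_mod_cast h.2
  have h₂ := h₁.trans (M.programCount_le x n)
  rw [two_pow_sub_eq h.1] at h₂
  exact (ENNReal.mul_le_mul_iff_right (by simp) (by simp)).1 h₂

/-- Strictness matters: the approximations tend to `Q` from below and need not reach it. -/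
theorem exists_exceeds {x : List Bool} {k : ℕ} (h : (2⁻¹ : ℝ≥0∞) ^ k < Q M x) :
    ∃ n, M.Exceeds x k n := by
  obtain ⟨n, hkn, hn⟩ := M.exists_lt_programCount x h k
  rw [← two_pow_sub_eq hkn] at hn
  exact ⟨n, hkn, by exact_mod_cast hn⟩

theorem primrecPred_exceeds :
    PrimrecPred fun a : (List Bool × ℕ) × ℕ => M.Exceeds a.1.1 a.1.2 a.2 := by
  have hx : Primrec fun a : (List Bool × ℕ) × ℕ => a.1.1 := Primrec.fst.comp Primrec.fst
  have hk : Primrec fun a : (List Bool × ℕ) × ℕ => a.1.2 := Primrec.snd.comp Primrec.fst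
  exact (Primrec.nat_le.comp hk Primrec.snd).and
    (Primrec.nat_le.comp (Primrec.two_pow.comp (Primrec.nat_sub.comp Primrec.snd hk))
      (M.primrec_programCount.comp hx Primrec.snd))

/-- The requests `(x, k + 1)` for all `x` and `k` such that the probability of `x` is seen to be at
least `2^{-k}` at some stage; the request is made when this happens first. -/
def codingRequest (i : ℕ) : Option (List Bool × ℕ) :=
  (Encodable.decode (α := (List Bool × ℕ) × ℕ) i).bind fun r =>
    if Encodable.encode r = i ∧ M.Exceeds r.1.1 r.1.2 r.2 ∧ ∀ m < r.2, ¬ M.Exceeds r.1.1 r.1.2 m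
    then some (r.1.1, r.1.2 + 1) else none

theorem codingRequest_eq_some {i k : ℕ} {x : List Bool} :
    M.codingRequest i = some (x, k) ↔ ∃ l n, k = l + 1 ∧ Encodable.encode ((x, l), n) = i ∧
      M.Exceeds x l n ∧ ∀ m < n, ¬ M.Exceeds x l m := by
  simp only [codingRequest, Option.bind_eq_some_iff, Option.ite_none_right_eq_some,
    Option.some.injEq, Prod.mk.injEq]
  constructor
  · rintro ⟨⟨⟨y, l⟩, n⟩, -, ⟨h₁, h₂⟩, rfl, rfl⟩
    exact ⟨l, n, rfl, h₁, h₂⟩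
  · rintro ⟨l, n, rfl, rfl, h⟩
    exact ⟨((x, l), n), Encodable.encodek _, ⟨rfl, h⟩, rfl, rfl⟩

/-- Only the first stage that witnesses the bound triggers a request, so no request is charged twice
in the weight estimate. -/
theorem codingRequest_index_eq {i j : ℕ} {r : List Bool × ℕ} (hi : M.codingRequest i = some r)
    (hj : M.codingRequest j = some r) : i = j := by
  obtain ⟨l, n, h₁, rfl, h₂, h₃⟩ := M.codingRequest_eq_some.1 hi
  obtain ⟨l', n', h₁', rfl, h₂', h₃'⟩ := M.codingRequest_eq_some.1 hj
  obtain rfl : l = l' := by omega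
  obtain rfl : n = n' := le_antisymm (not_lt.1 fun h => h₃ _ h h₂') (not_lt.1 fun h => h₃' _ h h₂)
  rfl

theorem primrec_codingRequest : Primrec M.codingRequest := by
  have hr : Primrec fun a : ℕ × ((List Bool × ℕ) × ℕ) => a.2 := Primrec.snd
  have hmin : PrimrecRel fun (n : ℕ) (r : List Bool × ℕ) => ∀ m < n, ¬ M.Exceeds r.1 r.2 m :=
    ((PrimrecRel.forall_mem_list (R := fun m (r : List Bool × ℕ) => ¬ M.Exceeds r.1 r.2 m)
      (M.primrecPred_exceeds.not.comp (Primrec.snd.pair Primrec.fst))).comp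
        (Primrec.list_range.comp Primrec.fst) Primrec.snd).of_eq fun a => by simp
  have hcond := (Primrec.eq.comp (Primrec.encode.comp hr) Primrec.fst).and
    ((M.primrecPred_exceeds.comp hr).and
      (hmin.comp (Primrec.snd.comp hr) (Primrec.fst.comp hr)))
  have hite := Primrec.ite hcond
    (Primrec.option_some.comp (((Primrec.fst.comp (Primrec.fst.comp hr))).pair
      (Primrec.succ.comp (Primrec.snd.comp (Primrec.fst.comp hr))))) (Primrec.const none)
  exact Primrec.option_bind Primrec.decode (hite.of_eq fun _ => rfl).to₂

end PrefixMachine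

/-- From the least admissible exponent `m` on, the terms form a geometric tail with sum `2 ·
2^{-m}`, which is at most `q` by the choice of `m`. -/
theorem ENNReal.tsum_two_inv_pow_of_two_mul_le (q : ℝ≥0∞) :
    ∑' k : ℕ, (if 2 * (2⁻¹ : ℝ≥0∞) ^ k ≤ q then (2⁻¹ : ℝ≥0∞) ^ k else 0) ≤ q := by
  classical
  by_cases h : ∃ k : ℕ, 2 * (2⁻¹ : ℝ≥0∞) ^ k ≤ q
  · let m := Nat.find h
    let g : ℕ → ℝ≥0∞ := fun k => if m ≤ k then 2⁻¹ ^ k else 0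
    calc _ ≤ ∑' k, g k := by
          refine ENNReal.tsum_le_tsum fun k => ?_
          by_cases hk : 2 * (2⁻¹ : ℝ≥0∞) ^ k ≤ q
          · have hmk : m ≤ k := Nat.find_min' h hk
            simp only [g, hk, hmk, if_true, le_refl]
          · simp [hk]
      _ = ∑' k, g (k + m) := by
          refine ((add_left_injective m).tsum_eq fun k hk => ?_).symm
          by_cases hmk : m ≤ k
          · exact ⟨k - m, Nat.sub_add_cancel hmk⟩
          · simp [g, hmk] at hk
      _ = 2 * 2⁻¹ ^ m := by
          simp only [g, Nat.le_add_left, if_true, pow_add]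
          rw [ENNReal.tsum_mul_right, ENNReal.tsum_geometric, ENNReal.one_sub_inv_two, inv_inv]
      _ ≤ q := Nat.find_spec h
  · push Not at h
    simp [fun k => not_le.2 (h k)]

namespace PrefixMachine

variable (M : PrefixMachine)

/-- A request `(x, k)` certifies `2 · 2^{-k} ≤ Q(x)`, so the requests for one `x` weigh at most
`Q(x)`, and `∑ Q(x) ≤ 1`. -/
theorem cumWeight_codingRequest_le_one (i : ℕ) : cumWeight M.codingRequest i ≤ 1 := by
  classical
  let F : List Bool × ℕ → ℝ≥0∞ := fun r => if 2 * (2⁻¹ : ℝ≥0∞) ^ r.2 ≤ Q M r.1 then 2⁻¹ ^ r.2 else 0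
  have hF : ∑' r, F r ≤ 1 := by
    rw [ENNReal.tsum_prod']
    exact (ENNReal.tsum_le_tsum fun x =>
      ENNReal.tsum_two_inv_pow_of_two_mul_le (Q M x)).trans M.tsum_Q_le_one
  rw [← ENNReal.ofReal_le_one]
  refine le_trans ?_ hF
  rw [cumWeight, ENNReal.ofReal_sum_of_nonneg fun _ _ => requestWeight_nonneg _]
  let s := (Finset.range i).filter fun j => (M.codingRequest j).isSome
  have hs : ∀ j ∈ s, ∃ r, M.codingRequest j = some r := fun j hj =>
    Option.isSome_iff_exists.1 (Finset.mem_filter.1 hj).2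
  obtain ⟨φ, hφ⟩ : ∃ φ : ℕ → List Bool × ℕ, ∀ j ∈ s, M.codingRequest j = some (φ j) :=
    -- The default is taken only outside `s`, where `φ` is never used.
    ⟨fun j => (M.codingRequest j).getD ([], 0), fun j hj => by
      obtain ⟨r, hr⟩ := hs j hj
      simp [hr]⟩
  have hinj : Set.InjOn φ s := fun j hj l hl h =>
    M.codingRequest_index_eq (hφ j hj) (h ▸ hφ l hl)
  calc ∑ j ∈ Finset.range i, ENNReal.ofReal (requestWeight (M.codingRequest j))
      = ∑ j ∈ s, ENNReal.ofReal (requestWeight (M.codingRequest j)) := by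
        refine (Finset.sum_filter_of_ne fun j _ hj => ?_).symm
        cases h : M.codingRequest j with
        | none => simp [h, requestWeight] at hj
        | some r => rfl
    _ = ∑ j ∈ s, F (φ j) := by
        refine Finset.sum_congr rfl fun j hj => ?_
        obtain ⟨l, n, hl, -, he, -⟩ := M.codingRequest_eq_some.1 (hφ j hj)
        have hle : 2 * (2⁻¹ : ℝ≥0∞) ^ (φ j).2 ≤ Q M (φ j).1 := by
          rw [hl, pow_succ', ← mul_assoc, ENNReal.mul_inv_cancel (by norm_num) (by norm_num),
            one_mul]
          exact he.le_Q
        simp only [F, hle, if_true]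
        rw [hφ j hj, requestWeight, Option.elim_some, ENNReal.ofReal_pow (by norm_num),
          ENNReal.ofReal_inv_of_pos (by norm_num)]
        simp
    _ = ∑ r ∈ s.image φ, F r := (Finset.sum_image hinj).symm
    _ ≤ ∑' r, F r := ENNReal.sum_le_tsum _

/-! ### The coding theorem -/

theorem K_le_of_computes {p x : List Bool} (h : M.Computes p x) : K M x ≤ p.length :=
  Nat.sInf_le ⟨p, rfl, h⟩

variable {M}

theorem Universal.Q_pos (hM : M.Universal) (x : List Bool) : 0 < Q M x := by
  obtain ⟨p, hp⟩ := hM.exists_program x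
  exact lt_of_lt_of_le (ENNReal.pow_pos (by simp) _)
    (ENNReal.le_tsum (⟨p, hp⟩ : {p : List Bool // M.Computes p x}))

variable (M) in
theorem Q_le_one (x : List Bool) : Q M x ≤ 1 := (ENNReal.le_tsum x).trans M.tsum_Q_le_one

/-- Levin's coding theorem. -/
theorem Universal.exists_Q_le (hM : M.Universal) :
    ∃ C : ℕ, ∀ x, Q M x ≤ 2 ^ C * 2⁻¹ ^ K M x := by
  obtain ⟨f, hf, hdom, hreq⟩ := exists_prefixFree_decoder M.codingRequest M.primrec_codingRequest
    M.cumWeight_codingRequest_le_one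
  obtain ⟨σ, hσ⟩ := hM f hf hdom
  -- With `2^{-(k+1)} < Q(x) ≤ 2^{-k}`, the request is `(x, k + 2)`, its codeword has length `k +
  -- 3`, and `σ` is put in front.
  refine ⟨σ.length + 3, fun x => ?_⟩
  classical
  have hex : ∃ k : ℕ, (2⁻¹ : ℝ≥0∞) ^ k < Q M x :=
    ENNReal.exists_inv_two_pow_lt (hM.Q_pos x).ne'
  obtain ⟨k, hk⟩ : ∃ k, Nat.find hex = k + 1 := by
    refine Nat.exists_eq_succ_of_ne_zero fun h0 => ?_
    have := Nat.find_spec hex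
    rw [h0, pow_zero] at this
    exact absurd (M.Q_le_one x) (not_le.2 this)
  have hlt := Nat.find_spec hex
  have hle : Q M x ≤ 2⁻¹ ^ k := not_lt.1 (Nat.find_min hex (by omega))
  rw [hk] at hlt
  have hE := M.exists_exceeds hlt
  have hi : M.codingRequest (Encodable.encode ((x, k + 1), Nat.find hE)) = some (x, k + 1 + 1) :=
    M.codingRequest_eq_some.2
      ⟨k + 1, Nat.find hE, rfl, rfl, Nat.find_spec hE, fun m hm => Nat.find_min hE hm⟩
  obtain ⟨w, hw, hx⟩ := hreq _ _ _ hi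
  have hK : K M x ≤ σ.length + 3 + k := by
    have := M.K_le_of_computes ((hσ w x).2 hx)
    rw [List.length_append, hw] at this
    omega
  calc Q M x ≤ 2⁻¹ ^ k := hle
    _ = 2 ^ (σ.length + 3) * 2⁻¹ ^ (σ.length + 3 + k) := by
        rw [pow_add _ (σ.length + 3) k, ← mul_assoc, ← mul_pow,
          ENNReal.mul_inv_cancel (by norm_num) (by norm_num), one_pow, one_mul]
    _ ≤ 2 ^ (σ.length + 3) * 2⁻¹ ^ K M x :=
        mul_le_mul_right (pow_le_pow_of_le_one zero_le (by simp) hK) _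

end PrefixMachine

/-! ### Depth and logical depth -/

section Depth

variable {U : PrefixMachine} {t : ℕ → ℕ} {x : List Bool}

theorem ENNReal.two_inv_pow_eq_rpow (n : ℕ) : (2⁻¹ : ℝ≥0∞) ^ n = 2 ^ (-(n : ℝ)) := by
  rw [ENNReal.rpow_neg, ENNReal.rpow_natCast, ENNReal.inv_pow]

theorem exists_program_of_Qtime_ne_zero (h : Qtime U t x ≠ 0) :
    ∃ p, U.ComputesWithin (t x.length) p x := by
  by_contra! h'
  have : IsEmpty {p : List Bool // U.ComputesWithin (t x.length) p x} := ⟨fun p => h' _ p.2⟩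
  exact h (by rw [Qtime, tsum_empty])

theorem exists_program_of_Ktime_eq {k : ℕ} (h : Ktime U t x = k) :
    ∃ p : List Bool, p.length = k ∧ U.ComputesWithin (t x.length) p x := by
  have hne : {n : ℕ∞ | ∃ p : List Bool,
      (p.length : ℕ∞) = n ∧ U.ComputesWithin (t x.length) p x}.Nonempty := by
    by_contra hemp
    rw [Set.not_nonempty_iff_eq_empty] at hemp
    rw [Ktime, hemp, sInf_empty] at h
    exact ENat.top_ne_natCast k h
  obtain ⟨p, hp, hw⟩ := csInf_mem hne
  exact ⟨p, by exact_mod_cast hp.trans h, hw⟩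

theorem two_inv_pow_le_Qtime {k : ℕ} (h : Ktime U t x = k) : (2⁻¹ : ℝ≥0∞) ^ k ≤ Qtime U t x := by
  obtain ⟨p, rfl, hp⟩ := exists_program_of_Ktime_eq h
  exact ENNReal.le_tsum (⟨p, hp⟩ : {p : List Bool // U.ComputesWithin (t x.length) p x})

theorem K_le_of_Ktime_eq {k : ℕ} (h : Ktime U t x = k) : K U x ≤ k := by
  obtain ⟨p, rfl, hp⟩ := exists_program_of_Ktime_eq h
  exact U.K_le_of_computes hp.computes

theorem Ktime_ne_top {p : List Bool} (hp : U.ComputesWithin (t x.length) p x) :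
    Ktime U t x ≠ ⊤ :=
  ne_top_of_le_ne_top (ENat.natCast_ne_top p.length) (sInf_le ⟨p, rfl, hp⟩)

/-- Finite depth excludes `K^t = ⊤`, and `K ≤ K^t` makes the truncated subtraction exact. -/
theorem Ktime_eq_of_depth_eq {b : ℕ} (h : depth U t x = b) :
    Ktime U t x = (K U x + b : ℕ) := by
  rw [depth] at h
  cases hk : Ktime U t x with
  | top => rw [hk, ENat.top_sub_natCast] at h; exact absurd h (ENat.top_ne_natCast b)
  | coe k =>
    have hle := K_le_of_Ktime_eq hk
    rw [hk] at h
    have : k - K U x = b := by exact_mod_cast h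
    congr 1
    omega

theorem Qtime_mono {t' : ℕ → ℕ} (h : t' x.length ≤ t x.length) : Qtime U t' x ≤ Qtime U t x :=
  ENNReal.tsum_mono_subtype (fun p : List Bool => (2⁻¹ : ℝ≥0∞) ^ p.length)
    (s := {p | U.ComputesWithin (t' x.length) p x}) (t := {p | U.ComputesWithin (t x.length) p x})
    fun _ hp => hp.mono h

/-- `Q^t(x)` depends on `t` only through `t(|x|)` and grows with it, so a bound attained by a faster
function passes to `t`. -/
theorem ldepth_le_iff (ht : TimeConstructible t) {b : ℝ} :
    ldepth U b x ≤ (t x.length : ℕ∞) ↔ (2 : ℝ≥0∞) ^ (-b) ≤ Qtime U t x / Q U x := by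
  refine ⟨fun h => ?_, fun h => sInf_le ⟨t, ht, rfl, h⟩⟩
  have hne : {T : ℕ∞ | ∃ t : ℕ → ℕ, TimeConstructible t ∧ (t x.length : ℕ∞) = T ∧
      (2 : ℝ≥0∞) ^ (-b) ≤ Qtime U t x / Q U x}.Nonempty := by
    by_contra hemp
    rw [Set.not_nonempty_iff_eq_empty] at hemp
    rw [ldepth, hemp, sInf_empty, top_le_iff] at h
    exact ENat.natCast_ne_top _ h
  obtain ⟨t', -, hT, hq⟩ := csInf_mem hne
  have hle : t' x.length ≤ t x.length := by
    rw [ldepth, ← hT] at h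
    exact_mod_cast h
  exact hq.trans (ENNReal.div_le_div_right (Qtime_mono hle) _)

theorem ldepth_anti {a b : ℝ} (hab : a ≤ b) : ldepth U b x ≤ ldepth U a x :=
  sInf_le_sInf fun _ ⟨t, ht, hT, hq⟩ => ⟨t, ht, hT,
    (ENNReal.rpow_le_rpow_of_exponent_le (by norm_num) (by linarith)).trans hq⟩

/-- If the level cannot be lowered by one, then it is at most the depth, up to a constant. -/
theorem exists_depth_eq_of_ldepth_eq (hU : U.Universal) {C : ℕ}
    (hC : ∀ x, Q U x ≤ 2 ^ C * 2⁻¹ ^ K U x) (ht : TimeConstructible t) {b : ℝ}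
    (hb : ldepth U b x = (t x.length : ℕ∞)) (hb' : ldepth U (b - 1) x ≠ (t x.length : ℕ∞)) :
    ∃ d : ℕ, depth U t x = (d : ℕ∞) ∧ b - ((C + 1 : ℕ) : ℝ) ≤ (d : ℝ) := by
  have hQ0 : Q U x ≠ 0 := (hU.Q_pos x).ne'
  have hQ1 : Q U x ≠ ⊤ := ne_top_of_le_ne_top ENNReal.one_ne_top (U.Q_le_one x)
  have h₁ := (ldepth_le_iff ht).1 hb.le
  -- Lowering the level can only raise the logical depth, so if `b - 1` were still met within
  -- `t(|x|)`, its depth would be exactly `t(|x|)`.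
  have h₂ : ¬ (2 : ℝ≥0∞) ^ (-(b - 1)) ≤ Qtime U t x / Q U x := fun h =>
    hb' (le_antisymm ((ldepth_le_iff ht).2 h) (hb ▸ ldepth_anti (by linarith)))
  rw [ENNReal.le_div_iff_mul_le (Or.inl hQ0) (Or.inl hQ1)] at h₁ h₂
  have hpos : Qtime U t x ≠ 0 := fun h0 => by
    rw [h0, nonpos_iff_eq_zero, mul_eq_zero] at h₁
    exact h₁.elim (ENNReal.rpow_pos (by norm_num) (by norm_num)).ne' hQ0
  obtain ⟨p, hp⟩ := exists_program_of_Qtime_ne_zero hpos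
  obtain ⟨k, hk⟩ := ENat.ne_top_iff_exists.1 (Ktime_ne_top hp)
  have hKk := K_le_of_Ktime_eq hk.symm
  refine ⟨k - K U x, by rw [depth, ← hk, ENat.natCast_sub], ?_⟩
  by_contra! hlt
  -- A smaller depth would give `2^{-(b-1)} Q ≤ 2^{-(b-1)+C-K} ≤ 2^{-K^t} ≤ Q^t`, against the
  -- failure of level `b - 1`.
  refine h₂ (le_trans ?_ (two_inv_pow_le_Qtime hk.symm))
  refine (mul_le_mul_right (hC x) _).trans ?_
  rw [ENNReal.two_inv_pow_eq_rpow, ENNReal.two_inv_pow_eq_rpow, ← ENNReal.rpow_natCast,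
    ← ENNReal.rpow_add _ _ (by norm_num) (by norm_num),
    ← ENNReal.rpow_add _ _ (by norm_num) (by norm_num)]
  refine ENNReal.rpow_le_rpow_of_exponent_le (by norm_num) ?_
  push_cast [Nat.cast_sub hKk] at hlt
  linarith

theorem two_rpow_le_Qtime_div_of_depth_eq (hU : U.Universal) {C : ℕ}
    (hC : ∀ x, Q U x ≤ 2 ^ C * 2⁻¹ ^ K U x) {b : ℕ} (hb : depth U t x = (b : ℕ∞)) :
    (2 : ℝ≥0∞) ^ (-((b : ℝ) + C)) ≤ Qtime U t x / Q U x := by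
  have hQ0 : Q U x ≠ 0 := (hU.Q_pos x).ne'
  have hQ1 : Q U x ≠ ⊤ := ne_top_of_le_ne_top ENNReal.one_ne_top (U.Q_le_one x)
  rw [ENNReal.le_div_iff_mul_le (Or.inl hQ0) (Or.inl hQ1)]
  refine le_trans ?_ (two_inv_pow_le_Qtime (Ktime_eq_of_depth_eq hb))
  refine (mul_le_mul_right (hC x) _).trans ?_
  rw [ENNReal.two_inv_pow_eq_rpow, ENNReal.two_inv_pow_eq_rpow, ← ENNReal.rpow_natCast,
    ← ENNReal.rpow_add _ _ (by norm_num) (by norm_num),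
    ← ENNReal.rpow_add _ _ (by norm_num) (by norm_num)]
  refine ENNReal.rpow_le_rpow_of_exponent_le (by norm_num) ?_
  push_cast
  linarith

end Depth

theorem theorem1 (U : PrefixMachine) (hU : U.Universal) :
    -- (i), with the minimum over the integer levels, and with the minimum over the real levels
    ((∃ C : ℕ, ∀ t : ℕ → ℕ, TimeConstructible t → ∀ (x : List Bool) (b : ℤ),
        IsLeast {a : ℤ | ldepth U (a : ℝ) x = (t x.length : ℕ∞)} b →
        ∃ d : ℕ, depth U t x = (d : ℕ∞) ∧ (b : ℝ) - (C : ℝ) ≤ (d : ℝ)) ∧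
      (∃ C : ℕ, ∀ t : ℕ → ℕ, TimeConstructible t → ∀ (x : List Bool) (b : ℝ),
        IsLeast {a : ℝ | ldepth U a x = (t x.length : ℕ∞)} b →
        ∃ d : ℕ, depth U t x = (d : ℕ∞) ∧ b - (C : ℝ) ≤ (d : ℝ))) ∧
    -- (ii)
    (∃ C : ℕ, ∀ t : ℕ → ℕ, TimeConstructible t → ∀ (x : List Bool) (b : ℕ),
        depth U t x = (b : ℕ∞) →
        (2 : ENNReal) ^
            (-((b : ℝ) + ((min (K U (natString b) : ℕ∞) (Kfun t)).toNat : ℝ) + (C : ℝ))) ≤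
          Qtime U t x / Q U x ∧
        ldepth U ((b : ℝ) + ((min (K U (natString b) : ℕ∞) (Kfun t)).toNat : ℝ) + (C : ℝ)) x
          ≤ (t x.length : ℕ∞)) := by
  obtain ⟨C, hC⟩ := hU.exists_Q_le
  refine ⟨⟨⟨C + 1, fun t ht x b hb => ?_⟩, ⟨C + 1, fun t ht x b hb => ?_⟩⟩,
    ⟨C, fun t ht x b hb => ?_⟩⟩
  · refine exists_depth_eq_of_ldepth_eq hU hC ht hb.1 fun h => ?_
    have : b ≤ b - 1 := hb.2 (by simpa using h)
    omega
  · refine exists_depth_eq_of_ldepth_eq hU hC ht hb.1 fun h => ?_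
    have : b ≤ b - 1 := hb.2 h
    linarith
  · have hQ : (2 : ENNReal) ^
        (-((b : ℝ) + ((min (K U (natString b) : ℕ∞) (Kfun t)).toNat : ℝ) + (C : ℝ))) ≤
          Qtime U t x / Q U x := by
      refine le_trans (ENNReal.rpow_le_rpow_of_exponent_le (by norm_num) ?_)
        (two_rpow_le_Qtime_div_of_depth_eq hU hC hb)
      -- The minimum is finite because `K` is, so `toNat` is faithful; only its sign is needed.
      have : (0 : ℝ) ≤ ((min (K U (natString b) : ℕ∞) (Kfun t)).toNat : ℝ) := Nat.cast_nonneg _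
      linarith
    exact ⟨hQ, (ldepth_le_iff ht).2 hQ⟩
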